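/- Let $p\ge 2$ and $q\ge 1$, and let $\mathbb{C}_{p+q}$ be the complex Clifford algebra with generators $e_1,\dots,e_{p+q}$, $e_ie_j+e_je_i=-2\delta_{ij}$. Identify $x\in\mathbb{R}^p$ with $\sum_{j\le p}x_je_j$ and $y\in\mathbb{R}^q$ with $\sum_{k\le q}y_ke_{p+k}$, and put $\partial_x=\sum_{j\le p}e_j\partial_{x_j}$, $\partial_y=\sum_{k\le q}e_{p+k}\partial_{y_k}$. Let $s\in S^{q-1}$. A differentiable function $F$ on an open subset of $\mathbb{R}^p\times\mathbb{R}^q$ with values in $\mathbb{C}_{p+q}$ is called a hypermonogenic plane wave (with direction $s$) if $(\partial_x+\partial_y)F=0$ and, for $x\neq0$, $$F(x,y)=A+B\,\frac{x}{|x|}+C\,s+D\,\frac{x}{|x|}\,s$$ with differentiable complex-valued functions $A,B,C,D$ of $(|x|,\langle y,s\rangle)$. Proposition. The function $$G(x,\langle y,s\rangle)=\int_{S^{p-1}}e^{\langle x,t\rangle+i\langle y,s\rangle}(t+is)\,dS(t),$$ where $dS$ is the surface measure of $S^{p-1}$, is a hypermonogenic plane wave on all of $\mathbb{R}^p\times\mathbb{R}^q$,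 and for $x\ne 0$ $$G(x,\langle y,s\rangle)=\frac{\sqrt{\pi}\,\lambda_{p-1}\,2^{\frac{p-2}{2}}\,\Gamma(\frac{p-1}{2})}{|x|^{\frac{p-2}{2}}}\Big(i\,I_{\frac{p-2}{2}}(|x|)\,s+\frac{x}{|x|}\,I_{\frac p2}(|x|)\Big)e^{i\langle y,s\rangle}.$$ Here $\lambda_{p-1}$ is the total surface measure of the unit sphere $S^{p-2}$ of $\mathbb{R}^{p-1}$ (so $\lambda_1=2$), and $I_\nu(r)=\sum_{k\ge0}\frac{(r/2)^{2k+\nu}}{k!\,\Gamma(k+\nu+1)}$ is the modified Bessel function of the first kind. -/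

import Mathlib

open MeasureTheory
open scoped RealInnerProductSpace

noncomputable section

namespace HypermonogenicPlaneWave

/-- The quadratic form `z ↦ -∑ zⱼ²` on `ℂᵐ`. -/
def cliffordForm (m : ℕ) : QuadraticForm ℂ (Fin m → ℂ) :=
  QuadraticMap.weightedSumSquares ℂ (fun _ : Fin m => (-1 : ℂ))

/-- The complex Clifford algebra `ℂ_m`: generated over `ℂ` by `e₁, …, e_m` with
`eᵢ eⱼ + eⱼ eᵢ = -2 δᵢⱼ`. -/
def ComplexClifford (m : ℕ) : Type := CliffordAlgebra (cliffordForm m)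

instance (m : ℕ) : Ring (ComplexClifford m) :=
  inferInstanceAs (Ring (CliffordAlgebra (cliffordForm m)))

instance (m : ℕ) : Algebra ℂ (ComplexClifford m) :=
  inferInstanceAs (Algebra ℂ (CliffordAlgebra (cliffordForm m)))

/-- The generators `e_j` of `ℂ_m`. -/
def gen {m : ℕ} (j : Fin m) : ComplexClifford m :=
  CliffordAlgebra.ι (cliffordForm m) (Pi.single j 1)

theorem gen_mul_gen_self {m : ℕ} (j : Fin m) : gen j * gen j = -1 := by
  have h := CliffordAlgebra.ι_sq_scalar (cliffordForm m) (Pi.single j 1)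
  have h2 : cliffordForm m (Pi.single j 1) = -1 := by
    simp [cliffordForm, QuadraticMap.weightedSumSquares_apply, Pi.single_apply]
  rw [h2, map_neg, map_one] at h
  exact h

theorem gen_mul_gen_of_ne {m : ℕ} {j k : Fin m} (hjk : j ≠ k) :
    gen j * gen k + gen k * gen j = 0 := by
  have h := CliffordAlgebra.ι_mul_ι_add_swap (Q := cliffordForm m)
    (Pi.single j 1) (Pi.single k 1)
  have h2 : QuadraticMap.polar (cliffordForm m) (Pi.single j 1) (Pi.single k 1) = 0 := by
    simp only [QuadraticMap.polar, cliffordForm, QuadraticMap.weightedSumSquares_apply,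
      ← Finset.sum_sub_distrib]
    refine Finset.sum_eq_zero fun i _ => ?_
    by_cases h1 : i = j
    · subst h1; simp [hjk]
    · simp [Pi.single_apply, h1]
  rw [h2, map_zero] at h
  exact h

/-- The components `a_A` (`A` a set of indices) of an element `a = ∑ a_A e_A` of `ℂ_m`. -/
def components (m : ℕ) : ComplexClifford m ≃ₗ[ℂ] (Finset (Fin m) → ℂ) :=
  LinearEquiv.trans
    (show ComplexClifford m ≃ₗ[ℂ] ExteriorAlgebra ℂ (Fin m → ℂ) from
      CliffordAlgebra.equivExterior (cliffordForm m))
    (Pi.basisFun ℂ (Fin m)).ExteriorAlgebra.equivFun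

/-- `ℂ_m` is normed by the largest modulus of a component, so that limits, derivatives and
integrals of `ℂ_m`-valued functions are taken component by component. -/
instance (m : ℕ) : NormedAddCommGroup (ComplexClifford m) :=
  NormedAddCommGroup.induced (ComplexClifford m) (Finset (Fin m) → ℂ) (components m)
    (components m).injective

instance (m : ℕ) : NormedSpace ℂ (ComplexClifford m) :=
  NormedSpace.induced ℂ (ComplexClifford m) (Finset (Fin m) → ℂ) (components m)

variable {p q : ℕ}

/-- The vector `x = ∑_{j ≤ p} x_j e_j` of `ℂ_{p+q}` given by `x ∈ ℝᵖ`. -/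
def vecX (q : ℕ) (x : EuclideanSpace ℝ (Fin p)) : ComplexClifford (p + q) :=
  ∑ j : Fin p, (x j : ℂ) • gen (Fin.castAdd q j)

/-- The vector `y = ∑_{k ≤ q} y_k e_{p+k}` of `ℂ_{p+q}` given by `y ∈ ℝ^q`. -/
def vecY (p : ℕ) (y : EuclideanSpace ℝ (Fin q)) : ComplexClifford (p + q) :=
  ∑ k : Fin q, (y k : ℂ) • gen (Fin.natAdd p k)

/-- The Dirac operator `∂_x + ∂_y = ∑ e_j ∂_{x_j} + ∑ e_{p+k} ∂_{y_k}`, acting from the left. -/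
def dirac (F : EuclideanSpace ℝ (Fin p) × EuclideanSpace ℝ (Fin q) → ComplexClifford (p + q))
    (z : EuclideanSpace ℝ (Fin p) × EuclideanSpace ℝ (Fin q)) : ComplexClifford (p + q) :=
  ∑ j : Fin p, gen (Fin.castAdd q j) * fderiv ℝ F z (EuclideanSpace.single j 1, 0) +
    ∑ k : Fin q, gen (Fin.natAdd p k) * fderiv ℝ F z (0, EuclideanSpace.single k 1)

/-- `F` is (left) monogenic on the open set `Ω`. -/
structure IsMonogenicOn
    (F : EuclideanSpace ℝ (Fin p) × EuclideanSpace ℝ (Fin q) → ComplexClifford (p + q))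
    (Ω : Set (EuclideanSpace ℝ (Fin p) × EuclideanSpace ℝ (Fin q))) : Prop where
  isOpen : IsOpen Ω
  differentiableOn : DifferentiableOn ℝ F Ω
  dirac_eq_zero : ∀ z ∈ Ω, dirac F z = 0

/-- The set of the values that `(|x|, ⟨y, s⟩)` takes for `(x, y) ∈ Ω`. -/
def profileSet (s : EuclideanSpace ℝ (Fin q))
    (Ω : Set (EuclideanSpace ℝ (Fin p) × EuclideanSpace ℝ (Fin q))) : Set (ℝ × ℝ) :=
  (fun z => (‖z.1‖, ⟪z.2, s⟫)) '' Ω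

/-- `F` is a hypermonogenic plane wave on `Ω` with direction `s ∈ S^{q-1}`: it is monogenic and
`F = A + B (x/|x|) + C s + D (x/|x|) s` with differentiable complex-valued functions
`A, B, C, D` of `(|x|, ⟨y, s⟩)`. The formula is required where `x/|x|` is defined; at `x = 0`
the value of `F` is its limit. -/
structure IsHypermonogenicPlaneWaveOn (s : EuclideanSpace ℝ (Fin q))
    (F : EuclideanSpace ℝ (Fin p) × EuclideanSpace ℝ (Fin q) → ComplexClifford (p + q))
    (Ω : Set (EuclideanSpace ℝ (Fin p) × EuclideanSpace ℝ (Fin q))) : Prop where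
  norm_direction : ‖s‖ = 1
  monogenic : IsMonogenicOn F Ω
  exists_profile : ∃ A B C D : ℝ × ℝ → ℂ,
    DifferentiableOn ℝ A (profileSet s Ω) ∧ DifferentiableOn ℝ B (profileSet s Ω) ∧
    DifferentiableOn ℝ C (profileSet s Ω) ∧ DifferentiableOn ℝ D (profileSet s Ω) ∧
    ∀ x y, (x, y) ∈ Ω → x ≠ 0 →
      F (x, y) = A (‖x‖, ⟪y, s⟫) • (1 : ComplexClifford (p + q))
        + B (‖x‖, ⟪y, s⟫) • vecX q (‖x‖⁻¹ • x)
        + C (‖x‖, ⟪y, s⟫) • vecY p s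
        + D (‖x‖, ⟪y, s⟫) • (vecX q (‖x‖⁻¹ • x) * vecY p s)

/-- The surface measure on the unit sphere `S^{n-1}` of `ℝⁿ`. -/
def surfaceMeasure (n : ℕ) : Measure (Metric.sphere (0 : EuclideanSpace ℝ (Fin n)) 1) :=
  (volume : Measure (EuclideanSpace ℝ (Fin n))).toSphere

/-- The total surface measure of the unit sphere of `ℝⁿ`. -/
def sphereArea (n : ℕ) : ℝ := (surfaceMeasure n).real Set.univ

/-- The modified Bessel function of the first kind
`I_ν(r) = ∑ₖ (r/2)^{2k+ν} / (k! Γ(k+ν+1))`, for `ν ≥ 0` and `r > 0`. -/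
def besselI (ν r : ℝ) : ℝ :=
  ∑' k : ℕ, (r / 2) ^ (2 * (k : ℝ) + ν) / ((k.factorial : ℝ) * Real.Gamma ((k : ℝ) + ν + 1))

/-- `G(x, ⟨y, s⟩) = ∫_{S^{p-1}} e^{⟨x,t⟩ + i⟨y,s⟩} (t + i s) dS(t)`. -/
def waveG (s : EuclideanSpace ℝ (Fin q))
    (z : EuclideanSpace ℝ (Fin p) × EuclideanSpace ℝ (Fin q)) : ComplexClifford (p + q) :=
  ∫ t : Metric.sphere (0 : EuclideanSpace ℝ (Fin p)) 1,
    Complex.exp ((⟪z.1, t.1⟫ : ℂ) + Complex.I * (⟪z.2, s⟫ : ℂ)) •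
      (vecX q t.1 + Complex.I • vecY p s) ∂(surfaceMeasure p)

end HypermonogenicPlaneWave

end

/-! Everything rests on the scalar function M(x) = ∫ e^{⟨x,t⟩} dS(t). Since the integral of
e^{⟨x,t⟩} t is the gradient of M, G = e^{i⟨y,s⟩} (∂_x M + i M s).

Expanding the exponential reduces M to the moments of ⟨x,t⟩ on the sphere. These follow from
computing the integral of ⟨x,u⟩^k e^{-|u|²} twice: in polar coordinates, and by rotating x onto an
axis and factoring the Gaussian. The result is M(x) = 2 π^{p/2} H_{p/2}(|x|²/4), and H_a' = H_{a+1}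
gives the gradient.

In the Dirac operator applied to G the mixed terms cancel because x and s anticommute; what remains
is e^{i⟨y,s⟩} (M - ΔM). This vanishes by the recurrence `besselSeries_recurrence`, which is ΔM = M
in radial form. -/

noncomputable section

namespace HypermonogenicPlaneWave

variable {p q : ℕ}

/-! ### The series H_a: convergence, derivative, recurrence -/

/-- The entire function `H_a(w) = ∑ₖ wᵏ / (k! Γ(k + a))`, so that
`I_ν(r) = (r/2)^ν H_{ν+1}((r/2)²)`. -/
def besselSeries (a w : ℝ) : ℝ :=
  ∑' k : ℕ, w ^ k / ((k.factorial : ℝ) * Real.Gamma ((k : ℝ) + a))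

/-- Each step multiplies by k + a ≥ 1. Hence the series H_a is dominated by an exponential series;
in the application a ≥ p/2 ≥ 1. -/
theorem gamma_le_gamma_nat_add {a : ℝ} (ha : 1 ≤ a) (k : ℕ) :
    Real.Gamma a ≤ Real.Gamma ((k : ℝ) + a) := by
  induction k with
  | zero => simp
  | succ k ih =>
    have hk : (1 : ℝ) ≤ k + a := by have := k.cast_nonneg (α := ℝ); linarith
    have h : Real.Gamma (((k + 1 : ℕ) : ℝ) + a) = ((k : ℝ) + a) * Real.Gamma ((k : ℝ) + a) := by
      rw [← Real.Gamma_add_one (by linarith)]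
      push_cast
      ring_nf
    rw [h]
    nlinarith [Real.Gamma_pos_of_pos (show (0 : ℝ) < k + a by linarith)]

theorem norm_div_factorial_mul_gamma_le {a : ℝ} (ha : 1 ≤ a) (k : ℕ) (c : ℝ) :
    ‖c / ((k.factorial : ℝ) * Real.Gamma ((k : ℝ) + a))‖ ≤
      |c| / k.factorial * (Real.Gamma a)⁻¹ := by
  have h0 : 0 < Real.Gamma a := Real.Gamma_pos_of_pos (by linarith)
  have h1 := gamma_le_gamma_nat_add ha k
  have h2 : (0 : ℝ) < k.factorial := by positivity
  rw [Real.norm_eq_abs, abs_div, abs_of_pos (mul_pos h2 (h0.trans_le h1)), ← div_div, div_eq_mul_inv]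
  gcongr

theorem hasSum_besselSeries {a : ℝ} (ha : 1 ≤ a) (w : ℝ) :
    HasSum (fun k : ℕ => w ^ k / ((k.factorial : ℝ) * Real.Gamma ((k : ℝ) + a)))
      (besselSeries a w) := by
  refine (Summable.of_norm_bounded
    ((Real.summable_pow_div_factorial |w|).mul_right (Real.Gamma a)⁻¹) fun k => ?_).hasSum
  simpa using norm_div_factorial_mul_gamma_le ha k (w ^ k)

/-- Termwise differentiation turns 1/k! into 1/(k-1)!, and the index shift then raises a by one. The
ball of radius |w| + 1 provides a uniform bound on the derived series. -/
theorem hasDerivAt_besselSeries {a : ℝ} (ha : 1 ≤ a) (w : ℝ) :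
    HasDerivAt (besselSeries a) (besselSeries (a + 1) w) w := by
  have hshift (y : ℝ) (k : ℕ) : ((k + 1 : ℕ) : ℝ) * y ^ (k + 1 - 1) /
      (((k + 1).factorial : ℝ) * Real.Gamma (((k + 1 : ℕ) : ℝ) + a)) =
      y ^ k / ((k.factorial : ℝ) * Real.Gamma ((k : ℝ) + (a + 1))) := by
    have hg : Real.Gamma ((k : ℝ) + (a + 1)) ≠ 0 := by
      refine (Real.Gamma_pos_of_pos ?_).ne'
      positivity
    have hg' : ((k + 1 : ℕ) : ℝ) + a = k + (a + 1) := by push_cast; ring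
    rw [hg', Nat.factorial_succ, Nat.add_sub_cancel]
    have : ((k + 1 : ℕ) : ℝ) ≠ 0 := by positivity
    push_cast at this ⊢
    field_simp
  have hsum : Summable fun k : ℕ =>
      (k : ℝ) * (|w| + 1) ^ (k - 1) / k.factorial * (Real.Gamma a)⁻¹ := by
    refine Summable.mul_right _ ((summable_nat_add_iff 1).1 ?_)
    refine (Real.summable_pow_div_factorial (|w| + 1)).congr fun k => ?_
    rw [Nat.factorial_succ, Nat.add_sub_cancel]
    push_cast
    field_simp
  have hw : w ∈ Metric.ball (0 : ℝ) (|w| + 1) := by simp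
  have key := hasDerivAt_tsum_of_isPreconnected (t := Metric.ball (0 : ℝ) (|w| + 1)) (y₀ := w)
    (g := fun (k : ℕ) y => y ^ k / ((k.factorial : ℝ) * Real.Gamma ((k : ℝ) + a)))
    (g' := fun (k : ℕ) y => (k : ℝ) * y ^ (k - 1) / ((k.factorial : ℝ) * Real.Gamma ((k : ℝ) + a)))
    hsum Metric.isOpen_ball (convex_ball _ _).isPreconnected
    (fun k y _ => (hasDerivAt_pow k y).div_const _)
    (fun k y hy => by
      refine (norm_div_factorial_mul_gamma_le ha k _).trans ?_
      have : |y| ≤ |w| + 1 := by simpa using (mem_ball_zero_iff.1 hy).le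
      have hG : 0 < Real.Gamma a := Real.Gamma_pos_of_pos (by linarith)
      rw [abs_mul, abs_pow, Nat.abs_cast]
      gcongr)
    hw (hasSum_besselSeries ha w).summable hw
  refine key.congr_deriv ?_
  have h2 := (hasSum_besselSeries (show 1 ≤ a + 1 by linarith) w)
  simp only [← hshift] at h2
  have h3 := (hasSum_nat_add_iff (f := fun k : ℕ => (k : ℝ) * w ^ (k - 1) /
    ((k.factorial : ℝ) * Real.Gamma ((k : ℝ) + a))) 1).1 h2
  simpa using h3.tsum_eq

/-- The recurrence `H_a = a H_{a+1} + w H_{a+2}`. -/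
theorem besselSeries_recurrence {a : ℝ} (ha : 1 ≤ a) (w : ℝ) :
    besselSeries a w = a * besselSeries (a + 1) w + w * besselSeries (a + 1 + 1) w := by
  have h1 := (hasSum_besselSeries (show 1 ≤ a + 1 by linarith) w).mul_left a
  have h2 := (hasSum_besselSeries (show 1 ≤ a + 1 + 1 by linarith) w).mul_left w
  -- Shifted by one index so that both series run over w^k; the factor k kills the new term k = 0.
  have h2' : HasSum (fun k : ℕ => (k : ℝ) * w ^ k /
      ((k.factorial : ℝ) * Real.Gamma ((k : ℝ) + (a + 1)))) (w * besselSeries (a + 1 + 1) w) := by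
    rw [← hasSum_nat_add_iff' 1]
    simp only [Finset.range_one, Finset.sum_singleton, Nat.cast_zero, zero_mul, zero_div, sub_zero]
    refine h2.congr_fun fun k => ?_
    have hg : Real.Gamma ((k : ℝ) + (a + 1 + 1)) ≠ 0 := (Real.Gamma_pos_of_pos (by positivity)).ne'
    have hg' : ((k + 1 : ℕ) : ℝ) + (a + 1) = k + (a + 1 + 1) := by push_cast; ring
    rw [hg', Nat.factorial_succ]
    push_cast
    field_simp
    ring
  -- The coefficients agree because (a + k) / Γ(k + a + 1) = 1 / Γ(k + a).
  refine (hasSum_besselSeries ha w).unique ((h1.add h2').congr_fun fun k => ?_)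
  have hka : 0 < (k : ℝ) + a := by positivity
  have hg : Real.Gamma ((k : ℝ) + a) ≠ 0 := (Real.Gamma_pos_of_pos hka).ne'
  rw [← add_assoc, Real.Gamma_add_one hka.ne']
  field_simp
  ring

theorem besselI_eq {ν r : ℝ} (hr : 0 < r) :
    besselI ν r = (r / 2) ^ ν * besselSeries (ν + 1) (r ^ 2 / 4) := by
  rw [besselI, besselSeries, ← tsum_mul_left]
  refine tsum_congr fun k => ?_
  have h : (r / 2) ^ (2 * (k : ℝ)) = (r ^ 2 / 4) ^ k := by
    rw [show 2 * (k : ℝ) = ((2 * k : ℕ) : ℝ) by push_cast; ring, Real.rpow_natCast, pow_mul]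
    ring
  rw [Real.rpow_add (by positivity), h, add_assoc]
  ring

/-! ### Gaussian moments and moments of the sphere -/

theorem integral_pow_mul_exp_neg_sq_odd (k : ℕ) :
    ∫ t : ℝ, t ^ (2 * k + 1) * Real.exp (-t ^ 2) = 0 := by
  have h := integral_neg_eq_self (fun t : ℝ => t ^ (2 * k + 1) * Real.exp (-t ^ 2)) volume
  have h2 : ∀ t : ℝ, (-t) ^ (2 * k + 1) * Real.exp (-(-t) ^ 2) =
      -(t ^ (2 * k + 1) * Real.exp (-t ^ 2)) := fun t => by
    rw [Odd.neg_pow ⟨k, rfl⟩, neg_sq, neg_mul]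
  simp only [h2, integral_neg] at h
  linarith

theorem integral_Ioi_pow_mul_exp_neg_sq (k : ℕ) :
    ∫ t in Set.Ioi (0 : ℝ), t ^ k * Real.exp (-t ^ 2) = Real.Gamma (((k : ℝ) + 1) / 2) / 2 := by
  have h := integral_rpow_mul_exp_neg_rpow (p := 2) (q := k) (by norm_num)
    (by have := k.cast_nonneg (α := ℝ); linarith)
  simp only [Real.rpow_natCast, Real.rpow_two] at h
  rw [h]
  ring

theorem integral_pow_mul_exp_neg_sq_even (k : ℕ) :
    ∫ t : ℝ, t ^ (2 * k) * Real.exp (-t ^ 2) = Real.Gamma ((k : ℝ) + 1 / 2) := by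
  have h := integral_comp_abs (f := fun t : ℝ => t ^ (2 * k) * Real.exp (-t ^ 2))
  simp only [sq_abs, pow_mul] at h
  simp only [← pow_mul] at h
  rw [h, integral_Ioi_pow_mul_exp_neg_sq]
  push_cast
  ring_nf

theorem integral_coord_pow_mul_gaussian (n k : ℕ) :
    ∫ u : EuclideanSpace ℝ (Fin (n + 1)), u 0 ^ k * Real.exp (-‖u‖ ^ 2) =
      (∫ t : ℝ, t ^ k * Real.exp (-t ^ 2)) * √Real.pi ^ n := by
  rw [← (EuclideanSpace.volume_preserving_symm_measurableEquiv_toLp (Fin (n + 1))).symm.integral_comp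
    (MeasurableEquiv.measurableEmbedding _)]
  have h : ∀ v : Fin (n + 1) → ℝ,
      ((WithLp.toLp 2 v : EuclideanSpace ℝ (Fin (n + 1))) 0) ^ k *
        Real.exp (-‖(WithLp.toLp 2 v : EuclideanSpace ℝ (Fin (n + 1)))‖ ^ 2) =
      ∏ i, (if i = 0 then fun t : ℝ => t ^ k * Real.exp (-t ^ 2)
        else fun t : ℝ => Real.exp (-t ^ 2)) (v i) := by
    intro v
    rw [Fin.prod_univ_succ, EuclideanSpace.norm_sq_eq, Fin.sum_univ_succ, neg_add, Real.exp_add,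
      ← Finset.sum_neg_distrib, Real.exp_sum]
    simp [Fin.succ_ne_zero, mul_assoc]
  refine (integral_congr_ae (.of_forall h)).trans ?_
  have hpi : ∫ t : ℝ, Real.exp (-t ^ 2) = √Real.pi := by simpa using integral_gaussian 1
  rw [integral_fintype_prod_volume_eq_prod, Fin.prod_univ_succ]
  simp [Fin.succ_ne_zero, hpi]

/-- The Gaussian is invariant under isometries, so x may be moved onto the first axis. -/
theorem integral_inner_pow_mul_gaussian (n k : ℕ) (x : EuclideanSpace ℝ (Fin (n + 1))) :
    ∫ u : EuclideanSpace ℝ (Fin (n + 1)), ⟪x, u⟫ ^ k * Real.exp (-‖u‖ ^ 2) =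
      ‖x‖ ^ k * ((∫ t : ℝ, t ^ k * Real.exp (-t ^ 2)) * √Real.pi ^ n) := by
  let e : EuclideanSpace ℝ (Fin (n + 1)) := EuclideanSpace.single 0 ‖x‖
  -- Since x and e have equal norm, the reflection in the hyperplane orthogonal to x - e exchanges
  -- them.
  let R := (ℝ ∙ (x - e))ᗮ.reflection
  have hR : R x = e := Submodule.reflection_sub (by simp [e])
  have h : ∀ u, ⟪x, u⟫ ^ k * Real.exp (-‖u‖ ^ 2) =
      (fun u : EuclideanSpace ℝ (Fin (n + 1)) => ‖x‖ ^ k * (u 0 ^ k * Real.exp (-‖u‖ ^ 2))) (R u) := by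
    intro u
    rw [← R.inner_map_map x u, hR]
    simp [e, EuclideanSpace.inner_single_left, mul_pow, mul_assoc]
  refine (integral_congr_ae (.of_forall h)).trans ((R.measurePreserving.integral_comp
    R.toHomeomorph.measurableEmbedding
    fun u : EuclideanSpace ℝ (Fin (n + 1)) => ‖x‖ ^ k * (u 0 ^ k * Real.exp (-‖u‖ ^ 2))).trans ?_)
  rw [integral_const_mul, integral_coord_pow_mul_gaussian]

/-- With u = r t, homogeneity gives r^k ⟨x,t⟩^k and the volume element gives r^n, so the integral
splits into a sphere moment and a half-line Gaussian moment of order k + n. -/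
theorem integral_inner_pow_mul_gaussian_polar (n k : ℕ) (x : EuclideanSpace ℝ (Fin (n + 1))) :
    ∫ u : EuclideanSpace ℝ (Fin (n + 1)), ⟪x, u⟫ ^ k * Real.exp (-‖u‖ ^ 2) =
      (∫ t, ⟪x, t.1⟫ ^ k ∂surfaceMeasure (n + 1)) * (Real.Gamma (((k + n : ℕ) + 1 : ℝ) / 2) / 2) := by
  let μ : Measure (EuclideanSpace ℝ (Fin (n + 1))) := volume
  let E := EuclideanSpace ℝ (Fin (n + 1))
  calc
    _ = ∫ u : ({(0)}ᶜ : Set E), ⟪x, u.1⟫ ^ k * Real.exp (-‖u.1‖ ^ 2) ∂(μ.comap (↑)) := by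
      rw [integral_subtype_comap (measurableSet_singleton _).compl
        fun u : E => ⟪x, u⟫ ^ k * Real.exp (-‖u‖ ^ 2), restrict_compl_singleton]
    _ = ∫ z : Metric.sphere (0 : E) 1 × Set.Ioi (0 : ℝ),
          ⟪x, z.1.1⟫ ^ k * (z.2.1 ^ k * Real.exp (-z.2.1 ^ 2))
          ∂μ.toSphere.prod (.volumeIoiPow (Module.finrank ℝ E - 1)) := by
      rw [← μ.measurePreserving_homeomorphUnitSphereProd.integral_comp
        (Homeomorph.measurableEmbedding _)]
      refine integral_congr_ae (.of_forall fun u => ?_)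
      have hu : ‖u.1‖ ≠ 0 := norm_ne_zero_iff.2 u.2
      simp only [homeomorphUnitSphereProd_apply_fst_coe, homeomorphUnitSphereProd_apply_snd_coe,
        inner_smul_right, mul_pow, inv_pow]
      field_simp
    _ = (∫ t, ⟪x, t.1⟫ ^ k ∂surfaceMeasure (n + 1)) *
          ∫ r : Set.Ioi (0 : ℝ), r.1 ^ k * Real.exp (-r.1 ^ 2) ∂.volumeIoiPow n := by
      rw [finrank_euclideanSpace_fin, Nat.add_sub_cancel]
      exact integral_prod_mul (μ := μ.toSphere) (ν := .volumeIoiPow n)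
        (fun t : Metric.sphere (0 : E) 1 => ⟪x, t.1⟫ ^ k)
        (fun r : Set.Ioi (0 : ℝ) => r.1 ^ k * Real.exp (-r.1 ^ 2))
    _ = _ := by
      congr 1
      rw [← integral_Ioi_pow_mul_exp_neg_sq]
      simp only [Measure.volumeIoiPow, ENNReal.ofReal]
      rw [integral_withDensity_eq_integral_smul,
        integral_subtype_comap measurableSet_Ioi fun a : ℝ =>
          Real.toNNReal (a ^ n) • (a ^ k * Real.exp (-a ^ 2)),
        setIntegral_congr_fun measurableSet_Ioi fun r hr => ?_]
      · rw [NNReal.smul_def, Real.coe_toNNReal _ (pow_nonneg (le_of_lt hr) _), smul_eq_mul]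
        ring
      · exact (measurable_subtype_coe.pow_const _).real_toNNReal

theorem integral_sphere_inner_pow_odd (n k : ℕ) (x : EuclideanSpace ℝ (Fin (n + 1))) :
    ∫ t, ⟪x, t.1⟫ ^ (2 * k + 1) ∂surfaceMeasure (n + 1) = 0 := by
  have h := (integral_inner_pow_mul_gaussian_polar n (2 * k + 1) x).symm.trans
    (integral_inner_pow_mul_gaussian n (2 * k + 1) x)
  rw [integral_pow_mul_exp_neg_sq_odd, zero_mul, mul_zero] at h
  refine (mul_eq_zero.1 h).resolve_right ?_
  have := Real.Gamma_pos_of_pos (show (0 : ℝ) < ((2 * k + 1 + n : ℕ) + 1 : ℝ) / 2 by positivity)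
  positivity

theorem integral_sphere_inner_pow_even (n k : ℕ) (x : EuclideanSpace ℝ (Fin (n + 1))) :
    (∫ t, ⟪x, t.1⟫ ^ (2 * k) ∂surfaceMeasure (n + 1)) / (2 * k).factorial =
      2 * √Real.pi ^ (n + 1) * ((‖x‖ ^ 2 / 4) ^ k /
        (k.factorial * Real.Gamma (k + ((n + 1 : ℕ) : ℝ) / 2))) := by
  have h := (integral_inner_pow_mul_gaussian_polar n (2 * k) x).symm.trans
    (integral_inner_pow_mul_gaussian n (2 * k) x)
  have hg : ((2 * k + n : ℕ) + 1 : ℝ) / 2 = k + ((n + 1 : ℕ) : ℝ) / 2 := by push_cast; ring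
  have hG := Real.Gamma_pos_of_pos (show (0 : ℝ) < k + ((n + 1 : ℕ) : ℝ) / 2 by positivity)
  -- Legendre duplication at k + 1/2, which converts Γ(k + 1/2) / (2k)! into √π / (4^k k!).
  have hd : Real.Gamma ((k : ℝ) + 1 / 2) * (4 ^ k * k.factorial) =
      (2 * k).factorial * √Real.pi := by
    have h1 := Real.Gamma_mul_Gamma_add_half ((k : ℝ) + 1 / 2)
    rw [show (k : ℝ) + 1 / 2 + 1 / 2 = k + 1 by ring,
      show 2 * ((k : ℝ) + 1 / 2) = ((2 * k : ℕ) : ℝ) + 1 by push_cast; ring,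
      Real.Gamma_nat_eq_factorial, Real.Gamma_nat_eq_factorial,
      show 1 - (((2 * k : ℕ) : ℝ) + 1) = -((2 * k : ℕ) : ℝ) by ring,
      Real.rpow_neg (by norm_num), Real.rpow_natCast, pow_mul] at h1
    have h4 : ((2 : ℝ) ^ 2) ^ k = 4 ^ k := by norm_num
    rw [h4] at h1
    have : (4 : ℝ) ^ k ≠ 0 := by positivity
    generalize Real.Gamma ((k : ℝ) + 1 / 2) = g at h1 ⊢
    field_simp at h1
    linarith
  rw [integral_pow_mul_exp_neg_sq_even, hg] at h
  rw [div_pow, ← pow_mul, pow_succ]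
  generalize Real.Gamma ((k : ℝ) + ((n + 1 : ℕ) : ℝ) / 2) = g at h hG ⊢
  field_simp
  linear_combination 2 * (4 ^ k * (k.factorial : ℝ)) * h + 2 * ‖x‖ ^ (2 * k) * √Real.pi ^ n * hd

/-! ### Exponential integrals over the sphere -/

instance (n : ℕ) : IsFiniteMeasure (surfaceMeasure n) :=
  inferInstanceAs (IsFiniteMeasure (volume : Measure (EuclideanSpace ℝ (Fin n))).toSphere)

theorem abs_inner_sphere_le {n : ℕ} (x : EuclideanSpace ℝ (Fin n))
    (t : Metric.sphere (0 : EuclideanSpace ℝ (Fin n)) 1) : |⟪x, t.1⟫| ≤ ‖x‖ := by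
  simpa using abs_real_inner_le_norm x t.1

theorem integrable_sphere_of_continuous {n : ℕ} {F : Type*} [NormedAddCommGroup F]
    {f : Metric.sphere (0 : EuclideanSpace ℝ (Fin n)) 1 → F} (hf : Continuous f) :
    Integrable f (surfaceMeasure n) := by
  rw [← integrableOn_univ]
  exact hf.continuousOn.integrableOn_compact isCompact_univ

theorem hasSum_integral_sphere_inner_pow {n : ℕ} (x : EuclideanSpace ℝ (Fin n)) :
    HasSum (fun k : ℕ => (∫ t, ⟪x, t.1⟫ ^ k ∂surfaceMeasure n) / k.factorial)
      (∫ t, Real.exp ⟪x, t.1⟫ ∂surfaceMeasure n) := by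
  have hint (k : ℕ) : Integrable (fun t : Metric.sphere (0 : EuclideanSpace ℝ (Fin n)) 1 =>
      ⟪x, t.1⟫ ^ k / k.factorial) (surfaceMeasure n) :=
    integrable_sphere_of_continuous (by fun_prop)
  have h := hasSum_integral_of_summable_integral_norm hint ?_
  · simp only [integral_div] at h
    convert! h using 3 with t
    rw [Real.exp_eq_exp_ℝ, NormedSpace.exp_eq_tsum_div]
  · refine Summable.of_nonneg_of_le (fun k => integral_nonneg fun t => norm_nonneg _) (fun k => ?_)
      ((Real.summable_pow_div_factorial ‖x‖).mul_left ((surfaceMeasure n).real Set.univ))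
    have hle : ∀ t : Metric.sphere (0 : EuclideanSpace ℝ (Fin n)) 1,
        ‖⟪x, t.1⟫ ^ k / (k.factorial : ℝ)‖ ≤ ‖x‖ ^ k / k.factorial := fun t => by
      rw [norm_div, norm_pow, Real.norm_eq_abs, RCLike.norm_natCast]
      gcongr
      exact abs_inner_sphere_le x t
    refine (integral_mono (hint k).norm (integrable_const _) hle).trans ?_
    simp

/-- The integral of `t ↦ e^{⟨x,t⟩}` over the unit sphere. -/
theorem integral_sphere_exp_inner (hp : 0 < p) (h2 : 1 ≤ (p : ℝ) / 2)
    (x : EuclideanSpace ℝ (Fin p)) :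
    ∫ t, Real.exp ⟪x, t.1⟫ ∂surfaceMeasure p =
      2 * √Real.pi ^ p * besselSeries ((p : ℝ) / 2) (‖x‖ ^ 2 / 4) := by
  obtain ⟨n, rfl⟩ : ∃ n, p = n + 1 := ⟨p - 1, by omega⟩
  refine (hasSum_integral_sphere_inner_pow x).unique ?_
  have he := (hasSum_besselSeries h2 (‖x‖ ^ 2 / 4)).mul_left (2 * √Real.pi ^ (n + 1))
  simp only [← integral_sphere_inner_pow_even] at he
  have ho : HasSum (fun k : ℕ => (∫ t, ⟪x, t.1⟫ ^ (2 * k + 1) ∂surfaceMeasure (n + 1)) /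
      (2 * k + 1).factorial) 0 := by
    simp only [integral_sphere_inner_pow_odd, zero_div]
    exact hasSum_zero
  have h := HasSum.even_add_odd (f := fun k : ℕ =>
    (∫ t, ⟪x, t.1⟫ ^ k ∂surfaceMeasure (n + 1)) / k.factorial) he ho
  rwa [add_zero] at h

theorem hasDerivAt_integral_sphere_exp_inner {n : ℕ} (x w : EuclideanSpace ℝ (Fin n)) :
    HasDerivAt (fun r : ℝ => ∫ t, Real.exp ⟪x + r • w, t.1⟫ ∂surfaceMeasure n)
      (∫ t, Real.exp ⟪x, t.1⟫ * ⟪w, t.1⟫ ∂surfaceMeasure n) 0 := by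
  have h := (hasDerivAt_integral_of_dominated_loc_of_deriv_le (μ := surfaceMeasure n)
    (F := fun (r : ℝ) t => Real.exp ⟪x + r • w, t.1⟫)
    (F' := fun (r : ℝ) t => Real.exp ⟪x + r • w, t.1⟫ * ⟪w, t.1⟫) (x₀ := 0)
    (bound := fun _ => Real.exp (‖x‖ + ‖w‖) * ‖w‖)
    (Metric.ball_mem_nhds 0 one_pos)
    (.of_forall fun r => (integrable_sphere_of_continuous (by fun_prop)).aestronglyMeasurable)
    (integrable_sphere_of_continuous (by fun_prop))
    (integrable_sphere_of_continuous (by fun_prop)).aestronglyMeasurable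
    (.of_forall fun t r hr => ?_) (integrable_const _) (.of_forall fun t r _ => ?_)).2
  · simpa using h
  · rw [norm_mul, Real.norm_eq_abs, Real.norm_eq_abs, Real.abs_exp]
    have h1 := (le_abs_self _).trans (abs_inner_sphere_le (x + r • w) t)
    have h2 : ‖x + r • w‖ ≤ ‖x‖ + ‖w‖ := by
      refine (norm_add_le _ _).trans ?_
      rw [norm_smul]
      have : ‖r‖ ≤ 1 := (mem_ball_zero_iff.1 hr).le
      nlinarith [norm_nonneg w]
    gcongr
    · exact h1.trans h2
    · exact abs_inner_sphere_le w t
  · have h1 : HasDerivAt (fun r : ℝ => ⟪x + r • w, t.1⟫) ⟪w, t.1⟫ r := by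
      simp only [inner_add_left, real_inner_smul_left]
      simpa using ((hasDerivAt_id r).mul_const ⟪w, t.1⟫).const_add ⟪x, t.1⟫
    exact h1.exp

/-- Both sides are the derivative at 0 of r ↦ M(x + r w): one under the integral sign, the other
from the closed form of M. -/
theorem integral_sphere_exp_inner_mul_inner (hp : 0 < p) (h2 : 1 ≤ (p : ℝ) / 2)
    (x w : EuclideanSpace ℝ (Fin p)) :
    ∫ t, Real.exp ⟪x, t.1⟫ * ⟪w, t.1⟫ ∂surfaceMeasure p =
      √Real.pi ^ p * besselSeries ((p : ℝ) / 2 + 1) (‖x‖ ^ 2 / 4) * ⟪x, w⟫ := by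
  refine (hasDerivAt_integral_sphere_exp_inner x w).unique ?_
  simp only [integral_sphere_exp_inner hp h2]
  have h0 : HasDerivAt (fun r : ℝ => ‖x + r • w‖ ^ 2 / 4) (⟪x, w⟫ / 2) 0 := by
    have h : HasDerivAt (fun r : ℝ => x + r • w) w 0 := by
      simpa using ((hasDerivAt_id (0 : ℝ)).smul_const w).const_add x
    refine (h.norm_sq.div_const 4).congr_deriv ?_
    simp
    ring
  have hx : ‖x‖ ^ 2 / 4 = ‖x + (0 : ℝ) • w‖ ^ 2 / 4 := by simp
  have h3 := hasDerivAt_besselSeries h2 (‖x‖ ^ 2 / 4)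
  rw [hx] at h3
  refine ((h3.comp (0 : ℝ) h0).const_mul (2 * √Real.pi ^ p)).congr_deriv ?_
  rw [← hx]
  ring

/-! ### Clifford relations for vectors -/

/-- Equal index maps f = g yield the squares of x and y; maps with disjoint ranges yield
anticommutation of x with y. -/
theorem sum_gen_mul_sum_gen_add_swap {m : ℕ} {ι κ : Type*} [Fintype ι] [Fintype κ]
    (f : ι → Fin m) (g : κ → Fin m) (a : ι → ℂ) (b : κ → ℂ) :
    (∑ i, a i • (gen (f i) : ComplexClifford m)) * ∑ k, b k • gen (g k) +
      (∑ k, b k • gen (g k)) * ∑ i, a i • gen (f i) =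
    (∑ i, ∑ k, if f i = g k then -2 * (a i * b k) else 0) • 1 := by
  rw [Finset.sum_mul_sum, Finset.sum_mul_sum, Finset.sum_comm (γ := κ), ← Finset.sum_add_distrib,
    Finset.sum_smul]
  refine Finset.sum_congr rfl fun i _ => ?_
  rw [← Finset.sum_add_distrib, Finset.sum_smul]
  refine Finset.sum_congr rfl fun k _ => ?_
  rw [smul_mul_smul_comm, smul_mul_smul_comm, mul_comm (b k), ← smul_add]
  split_ifs with h
  · rw [h, gen_mul_gen_self, mul_comm (-2 : ℂ), mul_smul (a i * b k), neg_smul, two_smul, neg_add]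
  · rw [gen_mul_gen_of_ne h, smul_zero, zero_smul]

theorem eq_of_add_self_eq {m : ℕ} {a : ComplexClifford m} {c : ℂ} (h : a + a = (2 * c) • 1) :
    a = c • 1 := by
  rw [← two_smul ℂ, mul_smul] at h
  exact smul_right_injective _ two_ne_zero h

theorem vecX_mul_self (x : EuclideanSpace ℝ (Fin p)) :
    vecX q x * vecX q x = (-(‖x‖ ^ 2 : ℝ) : ℂ) • 1 := by
  refine eq_of_add_self_eq ((sum_gen_mul_sum_gen_add_swap _ _ _ _).trans ?_)
  have h : ∑ i, (x i : ℂ) * x i = ‖x‖ ^ 2 := by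
    exact_mod_cast (by rw [EuclideanSpace.real_norm_sq_eq]; simp only [sq] : ∑ i, x i * x i = ‖x‖ ^ 2)
  simp [← Finset.mul_sum, h]

theorem vecY_mul_self (y : EuclideanSpace ℝ (Fin q)) :
    vecY p y * vecY p y = (-(‖y‖ ^ 2 : ℝ) : ℂ) • 1 := by
  refine eq_of_add_self_eq ((sum_gen_mul_sum_gen_add_swap _ _ _ _).trans ?_)
  have h : ∑ i, (y i : ℂ) * y i = ‖y‖ ^ 2 := by
    exact_mod_cast (by rw [EuclideanSpace.real_norm_sq_eq]; simp only [sq] : ∑ i, y i * y i = ‖y‖ ^ 2)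
  simp [← Finset.mul_sum, h]

theorem vecX_mul_vecY (x : EuclideanSpace ℝ (Fin p)) (y : EuclideanSpace ℝ (Fin q)) :
    vecX q x * vecY p y = -(vecY p y * vecX q x) := by
  refine eq_neg_of_add_eq_zero_left ((sum_gen_mul_sum_gen_add_swap _ _ _ _).trans ?_)
  have h (j : Fin p) (k : Fin q) : Fin.castAdd q j ≠ Fin.natAdd p k := by
    simp [Fin.ext_iff]
    omega
  simp [h]

/-- `vecX` as a real-linear map. -/
def vecXLin (p q : ℕ) : EuclideanSpace ℝ (Fin p) →ₗ[ℝ] ComplexClifford (p + q) where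
  toFun := vecX q
  map_add' x y := by simp [vecX, add_smul, Finset.sum_add_distrib]
  map_smul' r x := by
    simp only [vecX, Finset.smul_sum, PiLp.smul_apply, smul_eq_mul, Complex.ofReal_mul, mul_smul,
      RingHom.id_apply]
    rfl

theorem vecX_smul (r : ℝ) (x : EuclideanSpace ℝ (Fin p)) :
    vecX q (r • x) = (r : ℂ) • vecX q x :=
  (vecXLin p q).map_smul r x

theorem vecX_single (j : Fin p) : vecX q (EuclideanSpace.single j 1) = gen (Fin.castAdd q j) := by
  simp [vecX]

instance (m : ℕ) : FiniteDimensional ℂ (ComplexClifford m) :=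
  (components m).symm.finiteDimensional

instance (m : ℕ) : CompleteSpace (ComplexClifford m) := FiniteDimensional.complete ℂ _

/-! ### Closed form of G and monogenicity -/

theorem waveG_eq_integrals (s : EuclideanSpace ℝ (Fin q)) (x : EuclideanSpace ℝ (Fin p))
    (y : EuclideanSpace ℝ (Fin q)) :
    waveG s (x, y) = Complex.exp (Complex.I * ⟪y, s⟫) •
      (∑ j, ((∫ t, Real.exp ⟪x, t.1⟫ * ⟪EuclideanSpace.single j 1, t.1⟫ ∂surfaceMeasure p : ℝ) : ℂ) •
        gen (Fin.castAdd q j) +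
      (Complex.I * (∫ t, Real.exp ⟪x, t.1⟫ ∂surfaceMeasure p : ℝ)) • vecY p s) := by
  have hint (t : Metric.sphere (0 : EuclideanSpace ℝ (Fin p)) 1) :
      Complex.exp ((⟪x, t.1⟫ : ℂ) + Complex.I * (⟪y, s⟫ : ℂ)) •
        (vecX q t.1 + Complex.I • vecY p s) =
      Complex.exp (Complex.I * ⟪y, s⟫) •
        (∑ j, ((Real.exp ⟪x, t.1⟫ * ⟪EuclideanSpace.single j 1, t.1⟫ : ℝ) : ℂ) •
          (gen (Fin.castAdd q j) : ComplexClifford (p + q)) +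
        (Real.exp ⟪x, t.1⟫ : ℂ) • Complex.I • vecY p s) := by
    rw [add_comm ((⟪x, t.1⟫ : ℝ) : ℂ), Complex.exp_add, mul_smul, smul_add, vecX, Finset.smul_sum]
    congr 2
    · refine Finset.sum_congr rfl fun j _ => ?_
      rw [smul_smul]
      simp [EuclideanSpace.inner_single_left]
    · simp
  simp only [waveG, hint]
  rw [integral_smul, integral_add, integral_finsetSum]
  · simp only [integral_smul_const, integral_complex_ofReal, smul_smul]
    rw [integral_mul_const, integral_complex_ofReal, mul_comm _ Complex.I]
  · exact fun j _ => integrable_sphere_of_continuous (by fun_prop)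
  · exact integrable_sphere_of_continuous (by fun_prop)
  · exact integrable_sphere_of_continuous (by fun_prop)

/-- This form holds at x = 0 as well: it involves x and the entire functions H_a of |x|², never
x/|x|. Differentiability of G on the whole space is read off from it. -/
theorem waveG_eq (hp : 2 ≤ p) (s : EuclideanSpace ℝ (Fin q)) (x : EuclideanSpace ℝ (Fin p))
    (y : EuclideanSpace ℝ (Fin q)) :
    waveG s (x, y) =
      (Complex.exp (Complex.I * ⟪y, s⟫) *
        (√Real.pi ^ p * besselSeries ((p : ℝ) / 2 + 1) (‖x‖ ^ 2 / 4) : ℝ)) • vecX q x +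
      (Complex.exp (Complex.I * ⟪y, s⟫) *
        (2 * √Real.pi ^ p * besselSeries ((p : ℝ) / 2) (‖x‖ ^ 2 / 4) : ℝ)) •
          Complex.I • vecY p s := by
  have h2 : 1 ≤ (p : ℝ) / 2 := by
    have : (2 : ℝ) ≤ p := by exact_mod_cast hp
    linarith
  rw [waveG_eq_integrals, integral_sphere_exp_inner (by omega) h2, smul_add, vecX]
  simp only [integral_sphere_exp_inner_mul_inner (by omega) h2, Finset.smul_sum, smul_smul,
    EuclideanSpace.inner_single_right, one_mul, conj_trivial]
  congr 1
  · refine Finset.sum_congr rfl fun j _ => ?_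
    push_cast
    congr 1
    ring
  · congr 1
    ring

theorem hasFDerivAt_exp_mul_radial (s : EuclideanSpace ℝ (Fin q)) {f : ℝ → ℝ} {f' : ℝ}
    (z : EuclideanSpace ℝ (Fin p) × EuclideanSpace ℝ (Fin q))
    (hf : HasDerivAt f f' (‖z.1‖ ^ 2 / 4)) :
    ∃ L : EuclideanSpace ℝ (Fin p) × EuclideanSpace ℝ (Fin q) →L[ℝ] ℂ,
      HasFDerivAt (fun z : EuclideanSpace ℝ (Fin p) × EuclideanSpace ℝ (Fin q) =>
        Complex.exp (Complex.I * ⟪z.2, s⟫) * (f (‖z.1‖ ^ 2 / 4) : ℂ)) L z ∧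
      ∀ v w, L (v, w) = Complex.exp (Complex.I * ⟪z.2, s⟫) *
        (Complex.I * ⟪w, s⟫ * f (‖z.1‖ ^ 2 / 4) + f' * (⟪z.1, v⟫ / 2)) := by
  let E := EuclideanSpace ℝ (Fin p) × EuclideanSpace ℝ (Fin q)
  have h1 : HasFDerivAt (fun z : E => ‖z.1‖ ^ 2 / 4) _ z :=
    (((hasFDerivAt_fst (𝕜 := ℝ) (p := z)).norm_sq).mul_const (4 : ℝ)⁻¹)
  have h2 : HasFDerivAt (fun z : E => (f (‖z.1‖ ^ 2 / 4) : ℂ)) _ z :=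
    Complex.ofRealCLM.hasFDerivAt.comp z (hf.comp_hasFDerivAt z h1)
  have h3 : HasFDerivAt (fun z : E => ⟪z.2, s⟫) _ z :=
    (hasFDerivAt_snd (𝕜 := ℝ) (p := z)).inner ℝ (hasFDerivAt_const s z)
  have h4 : HasFDerivAt (fun z : E => Complex.exp (Complex.I * ⟪z.2, s⟫)) _ z :=
    ((Complex.ofRealCLM.hasFDerivAt.comp z h3).const_mul Complex.I).cexp
  refine ⟨_, h4.mul h2, fun v w => ?_⟩
  simp
  ring

theorem isMonogenicOn_waveG (hp : 2 ≤ p) (s : EuclideanSpace ℝ (Fin q)) (hs : ‖s‖ = 1) :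
    IsMonogenicOn (p := p) (waveG s) Set.univ := by
  have h2 : 1 ≤ (p : ℝ) / 2 := by
    have : (2 : ℝ) ≤ p := by exact_mod_cast hp
    linarith
  have key (z : EuclideanSpace ℝ (Fin p) × EuclideanSpace ℝ (Fin q)) :
      DifferentiableAt ℝ (waveG s) z ∧ dirac (waveG s) z = 0 := by
    obtain ⟨A, hA, hA'⟩ := hasFDerivAt_exp_mul_radial s z
      ((hasDerivAt_besselSeries (show 1 ≤ (p : ℝ) / 2 + 1 by linarith) (‖z.1‖ ^ 2 / 4)).const_mul
        (√Real.pi ^ p))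
    obtain ⟨B, hB, hB'⟩ := hasFDerivAt_exp_mul_radial s z
      ((hasDerivAt_besselSeries h2 (‖z.1‖ ^ 2 / 4)).const_mul (2 * √Real.pi ^ p))
    let L : EuclideanSpace ℝ (Fin p) × EuclideanSpace ℝ (Fin q) →L[ℝ] ComplexClifford (p + q) :=
      (LinearMap.toContinuousLinearMap (vecXLin p q)).comp (ContinuousLinearMap.fst ℝ _ _)
    have hX : HasFDerivAt (fun z : EuclideanSpace ℝ (Fin p) × EuclideanSpace ℝ (Fin q) =>
        vecX q z.1) L z := L.hasFDerivAt
    have hF : HasFDerivAt (waveG s) _ z :=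
      ((hA.smul hX).add (hB.smul_const (Complex.I • vecY p s))).congr_of_eventuallyEq
        (.of_forall fun z => waveG_eq hp s z.1 z.2)
    refine ⟨hF.differentiableAt, ?_⟩
    rw [dirac, hF.fderiv]
    set E := Complex.exp (Complex.I * ⟪z.2, s⟫)
    set X : ComplexClifford (p + q) := vecX q z.1
    set S : ComplexClifford (p + q) := vecY p s
    set H0 := besselSeries ((p : ℝ) / 2) (‖z.1‖ ^ 2 / 4) with hH0
    set H1 := besselSeries ((p : ℝ) / 2 + 1) (‖z.1‖ ^ 2 / 4)
    set H2 := besselSeries ((p : ℝ) / 2 + 1 + 1) (‖z.1‖ ^ 2 / 4)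
    -- The radial form of ΔM = M, from the recurrence at a = p/2 and w = |x|²/4.
    have hrec : (2 * H0 : ℂ) = p * H1 + ‖z.1‖ ^ 2 / 2 * H2 := by
      have h : 2 * H0 = p * H1 + ‖z.1‖ ^ 2 / 2 * H2 := by
        rw [hH0, besselSeries_recurrence h2]
        ring
      exact_mod_cast h
    -- The relation e_j² = -1 isolates a scalar, contributing p times in the sum; the remaining
    -- terms carry x_j e_j and sum to a left multiple of x.
    have hLX (j : Fin p) : gen (Fin.castAdd q j) *
        (((E * (√Real.pi ^ p * H1 : ℝ)) • vecX q (EuclideanSpace.single j 1) +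
          A (EuclideanSpace.single j 1, 0) • X) +
          B (EuclideanSpace.single j 1, 0) • Complex.I • S) =
        -((E * (√Real.pi ^ p * H1 : ℝ)) • 1) + ((z.1 j : ℂ) • gen (Fin.castAdd q j)) *
          ((E * (√Real.pi ^ p * H2 : ℝ) / 2) • X + (E * (√Real.pi ^ p * H1 : ℝ) * Complex.I) • S) := by
      rw [hA', hB', vecX_single, smul_mul_assoc, ← mul_smul_comm, add_assoc, mul_add, mul_smul_comm,
        gen_mul_gen_self, smul_neg, smul_add, smul_smul, smul_smul, smul_smul]
      congr 4
      · simp [EuclideanSpace.inner_single_right]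
        ring
      · simp [EuclideanSpace.inner_single_right]
        ring
    have hLY (k : Fin q) : gen (Fin.natAdd p k) *
        (((E * (√Real.pi ^ p * H1 : ℝ)) • vecX q 0 + A (0, EuclideanSpace.single k 1) • X) +
          B (0, EuclideanSpace.single k 1) • Complex.I • S) =
        ((s k : ℂ) • gen (Fin.natAdd p k)) * ((E * (√Real.pi ^ p * H1 : ℝ) * Complex.I) • X -
          (E * (2 * √Real.pi ^ p * H0 : ℝ)) • S) := by
      have h0 : vecX (p := p) q 0 = 0 := (vecXLin p q).map_zero
      rw [hA', hB', h0, smul_zero, zero_add, smul_mul_assoc, ← mul_smul_comm, sub_eq_add_neg,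
        ← neg_smul, smul_add, smul_smul, smul_smul, smul_smul]
      congr 3
      · simp [EuclideanSpace.inner_single_left]
        ring
      · simp [EuclideanSpace.inner_single_left]
        linear_combination (E * s k * 2 * √Real.pi ^ p * H0) * Complex.I_mul_I
    refine (congrArg₂ (· + ·) (Finset.sum_congr rfl fun j _ => hLX j)
      (Finset.sum_congr rfl fun k _ => hLY k)).trans ?_
    rw [Finset.sum_add_distrib, ← Finset.sum_mul, ← Finset.sum_mul, Finset.sum_const,
      Finset.card_univ, Fintype.card_fin]
    change _ + X * _ + S * _ = 0
    rw [mul_add, mul_sub, mul_smul_comm, mul_smul_comm, mul_smul_comm, mul_smul_comm,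
      vecX_mul_vecY, vecX_mul_self, vecY_mul_self, hs, ← Nat.cast_smul_eq_nsmul ℂ]
    simp only [smul_neg, smul_smul, ← neg_smul]
    -- The coefficient of 1 vanishes by the recurrence, that of s x by anticommutation.
    match_scalars
    · linear_combination (E * √Real.pi ^ p) * hrec
    · ring
  exact ⟨isOpen_univ, fun z _ => (key z).1.differentiableWithinAt, fun z _ => (key z).2⟩

/-! ### The Bessel form and the profile functions -/

theorem sqrt_pi_mul_sphereArea (hp : 2 ≤ p) :
    √Real.pi * sphereArea (p - 1) * (2 : ℝ) ^ (((p : ℝ) - 2) / 2) *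
      Real.Gamma (((p : ℝ) - 1) / 2) = 2 * √Real.pi ^ p * 2 ^ (((p : ℝ) - 2) / 2) := by
  obtain ⟨n, rfl⟩ : ∃ n, p = n + 1 + 1 := ⟨p - 2, by omega⟩
  -- The zeroth moment is the area: λ_{p-1} = 2 π^{(p-1)/2} / Γ((p-1)/2).
  have h := integral_sphere_inner_pow_even n 0 (0 : EuclideanSpace ℝ (Fin (n + 1)))
  have hG := Real.Gamma_pos_of_pos (show (0 : ℝ) < ((n + 1 : ℕ) : ℝ) / 2 by positivity)
  have hp1 : (((n + 1 + 1 : ℕ) : ℝ) - 1) / 2 = ((n + 1 : ℕ) : ℝ) / 2 := by push_cast; ring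
  have hs : sphereArea (n + 1) = 2 * √Real.pi ^ (n + 1) / Real.Gamma (((n + 1 : ℕ) : ℝ) / 2) := by
    simpa [sphereArea, div_eq_mul_inv] using h
  rw [Nat.add_sub_cancel, hp1, hs, pow_succ _ (n + 1)]
  field_simp

theorem waveG_eq_besselI (hp : 2 ≤ p) (s : EuclideanSpace ℝ (Fin q)) (x : EuclideanSpace ℝ (Fin p))
    (y : EuclideanSpace ℝ (Fin q)) (hx : x ≠ 0) :
    waveG s (x, y) =
      (((√Real.pi * sphereArea (p - 1) * (2 : ℝ) ^ (((p : ℝ) - 2) / 2) *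
          Real.Gamma (((p : ℝ) - 1) / 2) * ‖x‖ ^ (-(((p : ℝ) - 2) / 2)) : ℝ) : ℂ) *
        Complex.exp (Complex.I * (⟪y, s⟫ : ℂ))) •
      ((Complex.I * (besselI (((p : ℝ) - 2) / 2) ‖x‖ : ℂ)) • vecY p s +
        (besselI ((p : ℝ) / 2) ‖x‖ : ℂ) • vecX q (‖x‖⁻¹ • x)) := by
  have hr : 0 < ‖x‖ := norm_pos_iff.2 hx
  have hν : ((p : ℝ) - 2) / 2 + 1 = (p : ℝ) / 2 := by ring
  -- With ν = (p-2)/2, the prefactor cancels the power (|x|/2)^ν common to both Bessel functions.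
  -- The extra |x|/2 in I_{p/2} meets 1/|x| and accounts for the factor 1/2 between the two
  -- coefficients.
  have h0 : (2 : ℝ) ^ (((p : ℝ) - 2) / 2) * ‖x‖ ^ (-(((p : ℝ) - 2) / 2)) *
      (‖x‖ / 2) ^ (((p : ℝ) - 2) / 2) = 1 := by
    rw [Real.div_rpow hr.le two_pos.le, Real.rpow_neg hr.le]
    have := (Real.rpow_pos_of_pos hr (((p : ℝ) - 2) / 2)).ne'
    have := (Real.rpow_pos_of_pos (two_pos (α := ℝ)) (((p : ℝ) - 2) / 2)).ne'
    field_simp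
  have h1 : (‖x‖ / 2) ^ ((p : ℝ) / 2) = (‖x‖ / 2) ^ (((p : ℝ) - 2) / 2) * (‖x‖ / 2) := by
    rw [← hν, Real.rpow_add_one (by positivity)]
  rw [waveG_eq hp, sqrt_pi_mul_sphereArea hp, besselI_eq hr, besselI_eq hr, hν, h1, vecX_smul,
    add_comm (_ • vecX q x), smul_add]
  simp only [smul_smul]
  generalize besselSeries _ _ = u
  generalize besselSeries _ _ = v
  generalize (2 : ℝ) ^ (((p : ℝ) - 2) / 2) = a at *
  generalize ‖x‖ ^ (-(((p : ℝ) - 2) / 2)) = b at *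
  generalize (‖x‖ / 2) ^ (((p : ℝ) - 2) / 2) = c at *
  have h0' : (a : ℂ) * b * c = 1 := by exact_mod_cast h0
  have hr' : (‖x‖ : ℂ) ≠ 0 := by exact_mod_cast hr.ne'
  congr 2
  · push_cast
    linear_combination (-Complex.exp (Complex.I * ⟪y, s⟫) * 2 * √Real.pi ^ p * u * Complex.I) * h0'
  · push_cast
    field_simp
    linear_combination (-v : ℂ) * h0'

theorem exists_profile_waveG (hp : 2 ≤ p) (s : EuclideanSpace ℝ (Fin q)) :
    ∃ B C : ℝ × ℝ → ℂ, Differentiable ℝ B ∧ Differentiable ℝ C ∧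
      ∀ (x : EuclideanSpace ℝ (Fin p)) (y : EuclideanSpace ℝ (Fin q)), x ≠ 0 →
        waveG s (x, y) = B (‖x‖, ⟪y, s⟫) • vecX q (‖x‖⁻¹ • x) +
          C (‖x‖, ⟪y, s⟫) • vecY p s := by
  have h2 : 1 ≤ (p : ℝ) / 2 := by
    have : (2 : ℝ) ≤ p := by exact_mod_cast hp
    linarith
  have hd {a : ℝ} (ha : 1 ≤ a) : Differentiable ℝ fun r : ℝ × ℝ =>
      ((besselSeries a (r.1 ^ 2 / 4) : ℝ) : ℂ) := by
    have h : Differentiable ℝ (besselSeries a) := fun w =>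
      (hasDerivAt_besselSeries ha w).differentiableAt
    exact Complex.ofRealCLM.differentiable.comp (h.comp (by fun_prop))
  have hid : Differentiable ℝ fun r : ℝ × ℝ => (r.1 : ℂ) :=
    Complex.ofRealCLM.differentiable.comp differentiable_fst
  have hexp : Differentiable ℝ fun r : ℝ × ℝ => Complex.exp (Complex.I * r.2) :=
    ((Complex.ofRealCLM.differentiable.comp differentiable_snd).const_mul Complex.I).cexp
  -- The factor `r.1` in the first profile comes from x = |x| (x/|x|).
  refine ⟨fun r => Complex.exp (Complex.I * r.2) *
      ((√Real.pi ^ p : ℝ) * (besselSeries ((p : ℝ) / 2 + 1) (r.1 ^ 2 / 4) : ℝ) * r.1),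
    fun r => Complex.exp (Complex.I * r.2) *
      ((2 * √Real.pi ^ p : ℝ) * (besselSeries ((p : ℝ) / 2) (r.1 ^ 2 / 4) : ℝ) * Complex.I),
    hexp.mul (((hd (by linarith)).const_mul _).mul hid),
    hexp.mul (((hd h2).const_mul _).mul_const _), fun x y hx => ?_⟩
  have hr : (‖x‖ : ℂ) ≠ 0 := by exact_mod_cast norm_ne_zero_iff.2 hx
  rw [waveG_eq hp, vecX_smul, smul_smul, smul_smul]
  congr 2
  · push_cast
    field_simp
  · push_cast
    ring

end HypermonogenicPlaneWave

end

theorem mainTheorem5 (p q : ℕ) (hp : 2 ≤ p) (s : EuclideanSpace ℝ (Fin q)) (hs : ‖s‖ = 1) :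
    HypermonogenicPlaneWave.IsHypermonogenicPlaneWaveOn (p := p) s
        (HypermonogenicPlaneWave.waveG s) Set.univ ∧
      ∀ (x : EuclideanSpace ℝ (Fin p)) (y : EuclideanSpace ℝ (Fin q)), x ≠ 0 →
        HypermonogenicPlaneWave.waveG s (x, y) =
          (((√Real.pi * HypermonogenicPlaneWave.sphereArea (p - 1) *
                (2 : ℝ) ^ (((p : ℝ) - 2) / 2) * Real.Gamma (((p : ℝ) - 1) / 2) *
                ‖x‖ ^ (-(((p : ℝ) - 2) / 2)) : ℝ) : ℂ) *
              Complex.exp (Complex.I * (⟪y, s⟫ : ℂ))) •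
            ((Complex.I * (HypermonogenicPlaneWave.besselI (((p : ℝ) - 2) / 2) ‖x‖ : ℂ)) •
                HypermonogenicPlaneWave.vecY p s +
              (HypermonogenicPlaneWave.besselI ((p : ℝ) / 2) ‖x‖ : ℂ) •
                HypermonogenicPlaneWave.vecX q (‖x‖⁻¹ • x)) := by
  obtain ⟨B, C, hB, hC, h⟩ := HypermonogenicPlaneWave.exists_profile_waveG hp s
  -- G is vector-valued, so the scalar and bivector profiles A and D are zero.
  refine ⟨⟨hs, HypermonogenicPlaneWave.isMonogenicOn_waveG hp s hs, 0, B, C, 0,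
    differentiableOn_const 0, hB.differentiableOn, hC.differentiableOn, differentiableOn_const 0,
    fun x y _ hx => ?_⟩, fun x y hx => HypermonogenicPlaneWave.waveG_eq_besselI hp s x y hx⟩
  rw [h x y hx]
  simp
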